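/- Let $d,M,N\ge 1$ be integers and let $t_1,\dots,t_M$ be distinct points of the torus $\mathbb T^d=(\mathbb R/\mathbb Z)^d$. Let $$q:=\min_{j\ne k}\ \min_{r\in\mathbb Z^d}\|t_j-t_k+r\|_\infty$$ be their minimal separation (wrap-around) distance, with the conventions $q=\infty$ if $M=1$ and $\infty\cdot 0=0$. Let $$A=\bigl(z_j^{\nu}\bigr)_{1\le j\le M,\ \nu\in\{0,\dots,N-1\}^d}\in\mathbb C^{M\times N^d},\qquad z_j^{\nu}:=\prod_{s=1}^d e^{2\pi i\,\nu_s (t_j)_s},$$ be the associated multivariate rectangular Vandermonde matrix, and let $\sigma_{\min}(A)$ denote its smallest singular value, i.e. the last of its $\min(M,N^d)$ singular values in descending order. If $$q\,(N-1)\ \ge\ \frac{8\log d+14}{\pi},$$ where $\log$ is the natural logarithm, then $$\sigma_{\min}(A)\ \ge\ \frac1{\sqrt2}\left(\frac{\sqrt2}{3e^2}\cdot\frac1{\sqrt{\log d+1}}\right)^{d/2}(N-1)^{d/2}.$$ -/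

import Mathlib

open scoped ENNReal

namespace TorusVandermonde

/-- Minimal separation distance of the nodes `t 1, …, t M` on the torus `𝕋^d = (ℝ/ℤ)^d`: the
minimum of the wrap-around distances of distinct nodes. The distance of `Fin d → UnitAddCircle`
is the wrap-around distance (see `isLeast_wrapDist`). For a single node the value is `∞`. -/
noncomputable def minSep {d M : ℕ} (t : Fin M → Fin d → UnitAddCircle) : ℝ≥0∞ :=
  (Set.range t).einfsep

/-- The distance used in `minSep` is `min_{r ∈ ℤ^d} ‖x - y + r‖_∞`. -/
theorem isLeast_wrapDist {d : ℕ} (x y : Fin d → ℝ) :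
    IsLeast (Set.range fun r : Fin d → ℤ => ‖fun s => x s - y s + (r s : ℝ)‖)
      (dist (fun s => (x s : UnitAddCircle)) (fun s => (y s : UnitAddCircle))) := by
  have key : ∀ s, dist (x s : UnitAddCircle) (y s : UnitAddCircle)
      = |x s - y s - round (x s - y s)| := by
    intro s
    rw [dist_eq_norm, ← AddCircle.coe_sub, UnitAddCircle.norm_eq]
  constructor
  · refine ⟨fun s => -round (x s - y s), ?_⟩
    apply le_antisymm
    · refine (pi_norm_le_iff_of_nonneg dist_nonneg).2 fun s => ?_
      have h := dist_le_pi_dist (fun s => (x s : UnitAddCircle)) (fun s => (y s : UnitAddCircle)) s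
      rw [key] at h
      simpa [Real.norm_eq_abs, sub_eq_add_neg] using h
    · refine (dist_pi_le_iff (norm_nonneg _)).2 fun s => ?_
      have h := norm_le_pi_norm (fun s => x s - y s + ((-round (x s - y s) : ℤ) : ℝ)) s
      rw [key]
      simpa [Real.norm_eq_abs, sub_eq_add_neg] using h
  · rintro _ ⟨r, rfl⟩
    refine (dist_pi_le_iff (norm_nonneg _)).2 fun s => ?_
    have h := norm_le_pi_norm (fun s => x s - y s + (r s : ℝ)) s
    have h2 := round_le (x s - y s) (-r s)
    rw [key]
    refine h2.trans (le_trans (le_of_eq ?_) h)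
    simp [Real.norm_eq_abs]

/-- The multivariate rectangular Vandermonde matrix `A ∈ ℂ^{M × N^d}`, with entries
`z_j^ν = ∏ s, (z_j)_s ^ ν_s` where `(z_j)_s = exp(2πi (t_j)_s)` and `ν ∈ {0, …, N - 1}^d`. -/
noncomputable def vandermonde {d M : ℕ} (N : ℕ) (t : Fin M → Fin d → UnitAddCircle) :
    Matrix (Fin M) (Fin d → Fin N) ℂ :=
  Matrix.of fun j ν => ∏ s, (AddCircle.toCircle (t j s) : ℂ) ^ (ν s : ℕ)

/-- The smallest singular value of an `m × n` matrix: the last one of its `min(m, n)` singular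
values in descending order (Mathlib indexes these from `0`). -/
noncomputable def sigmaMin {m n : Type*} [Fintype m] [Fintype n] [DecidableEq n]
    (A : Matrix m n ℂ) : ℝ :=
  (Matrix.toEuclideanLin A).singularValues (min (Fintype.card m) (Fintype.card n) - 1)

end TorusVandermonde

/-! By duality (`le_sigmaMin`) it suffices to bound the energy `∑ ν, |∑ j, u j * conj (z_j^ν)|²`
over the box below by `c² ‖u‖²`. Let φ(x) = e^{2πiρx} (1 - (x/a)²)^p on (-a, a), with ρ = (N-1)/2
the centre of the frequency box and 2a at most the separation. The translates of φ ⊗ ... ⊗ φ to the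
nodes have disjoint supports, so Parseval (`hasSum_norm_sq_translates`) evaluates the sum over all
of ℤ^d of the energy weighted by ∏ |φ̂(ν_s)|². Differentiating the polynomial factor p times in
coordinate s inserts the weight (2π(ν_s-ρ))^{2p}, and that sum is explicit as well. The combination
R - ∑_s (2π(ν_s-ρ))^{2p}, with R = (π(N-1))^{2p}, is nonpositive off the box and at most R on it.
Hence the box alone carries at least the full weighted sum (`le_sum_box`). With p = ⌈log d⌉ + 1, a
power with exponent 2p absorbs the factor d from the d coordinates, and the derivative terms cost at
most half of the main term. What remains is the ratio ‖φ‖₂² / ‖φ‖₁², computed from I_m = ∫ (1-y²)^m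
over [-1, 1]. -/

namespace TorusVandermonde

/-! ### Smallest singular value from a lower bound on the adjoint. -/

section SingularValues

open Module InnerProductSpace

variable {E F : Type*} [NormedAddCommGroup E] [InnerProductSpace ℂ E] [FiniteDimensional ℂ E]
  [NormedAddCommGroup F] [InnerProductSpace ℂ F] [FiniteDimensional ℂ F]

/-- The squared norm of `T w`, expanded in the right singular vectors of `T`. -/
theorem norm_sq_apply_eq_sum_eigenvalues (T : E →ₗ[ℂ] F) {n : ℕ} (hn : finrank ℂ E = n) (w : E) :
    ‖T w‖ ^ 2 = ∑ i, T.isSymmetric_adjoint_comp_self.eigenvalues hn i *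
      ‖(T.isSymmetric_adjoint_comp_self.eigenvectorBasis hn).repr w i‖ ^ 2 := by
  set hs := T.isSymmetric_adjoint_comp_self
  set b := hs.eigenvectorBasis hn
  have h1 : ((‖T w‖ ^ 2 : ℝ) : ℂ) = inner ℂ w ((LinearMap.adjoint T ∘ₗ T) w) := by
    rw [LinearMap.comp_apply, LinearMap.adjoint_inner_right, inner_self_eq_norm_sq_to_K]
    norm_cast
  rw [← b.sum_inner_mul_inner w ((LinearMap.adjoint T ∘ₗ T) w)] at h1
  have h2 : ∀ i, inner ℂ w (b i) * inner ℂ (b i) ((LinearMap.adjoint T ∘ₗ T) w)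
      = ((hs.eigenvalues hn i * ‖b.repr w i‖ ^ 2 : ℝ) : ℂ) := by
    intro i
    have h3 := hs.eigenvectorBasis_apply_self_apply hn w i
    rw [OrthonormalBasis.repr_apply_apply] at h3
    rw [h3, ← inner_conj_symm w (b i), ← OrthonormalBasis.repr_apply_apply]
    push_cast
    rw [← Complex.conj_mul']
    exact mul_left_comm _ _ _
  rw [Finset.sum_congr rfl fun i _ => h2 i, ← Complex.ofReal_sum] at h1
  exact_mod_cast h1

/-- The adjoint is injective. This decides which dimension is the minimum in `sigmaMin`. -/
theorem finrank_le_of_forall_mul_norm_le_norm_adjoint (T : E →ₗ[ℂ] F) {c : ℝ} (hc : 0 < c)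
    (h : ∀ u, c * ‖u‖ ≤ ‖LinearMap.adjoint T u‖) : finrank ℂ F ≤ finrank ℂ E := by
  refine LinearMap.finrank_le_finrank_of_injective (f := LinearMap.adjoint T) ?_
  rw [injective_iff_map_eq_zero]
  intro u hu
  have := h u
  rw [hu, norm_zero] at this
  exact norm_le_zero_iff.1 (nonpos_of_mul_nonpos_right this hc)

/-- A lower bound for the adjoint of `T : E → F` bounds the `dim F`-th singular value of `T`. -/
theorem le_singularValues_of_forall_mul_norm_le_norm_adjoint (T : E →ₗ[ℂ] F) {c : ℝ} (hc : 0 < c)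
    (h : ∀ u, c * ‖u‖ ≤ ‖LinearMap.adjoint T u‖) (hF : 0 < finrank ℂ F) :
    c ≤ T.singularValues (finrank ℂ F - 1) := by
  have hle := finrank_le_of_forall_mul_norm_le_norm_adjoint T hc h
  set m := finrank ℂ F
  set hs := T.isSymmetric_adjoint_comp_self
  set b := hs.eigenvectorBasis rfl
  have hm : m - 1 < finrank ℂ E := by omega
  -- Only m - 1 conditions on the m-dimensional F: some u ≠ 0 has `w = T* u` orthogonal to the first
  -- m - 1 right singular vectors.
  let Φ : F →ₗ[ℂ] (Fin (m - 1) → ℂ) :=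
    LinearMap.pi fun i => (innerₛₗ ℂ (b ⟨i, i.2.trans hm⟩)) ∘ₗ LinearMap.adjoint T
  have hker : LinearMap.ker Φ ≠ ⊥ := by
    apply LinearMap.ker_ne_bot_of_finrank_lt
    rw [finrank_fin_fun]
    omega
  obtain ⟨u, hu, hu0⟩ := Submodule.exists_mem_ne_zero_of_ne_bot hker
  set w := LinearMap.adjoint T u with hw
  have hrepr : ∀ i : Fin (finrank ℂ E), (i : ℕ) < m - 1 → b.repr w i = 0 := by
    intro i hi
    have := congrFun (LinearMap.mem_ker.1 hu) ⟨i, hi⟩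
    simpa [Φ, OrthonormalBasis.repr_apply_apply] using this
  have hupos : 0 < ‖u‖ := norm_pos_iff.2 hu0
  have hwpos : 0 < ‖w‖ := lt_of_lt_of_le (mul_pos hc hupos) (h u)
  set σ := T.singularValues (m - 1) with hσ
  have hσ0 : 0 ≤ σ := T.singularValues_nonneg _
  have hupper : ‖T w‖ ^ 2 ≤ σ ^ 2 * ‖w‖ ^ 2 := by
    rw [norm_sq_apply_eq_sum_eigenvalues T rfl w, ← b.sum_sq_norm_inner_right w, Finset.mul_sum]
    refine Finset.sum_le_sum fun i _ => ?_
    rw [← OrthonormalBasis.repr_apply_apply]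
    by_cases hi : (i : ℕ) < m - 1
    · simp [b] at hrepr ⊢
      simp [hrepr i hi]
    · refine mul_le_mul_of_nonneg_right ?_ (by positivity)
      rw [hσ, T.sq_singularValues_of_lt rfl hm]
      exact hs.eigenvalues_antitone rfl (not_lt.1 hi)
  have hTw : ‖T w‖ ≤ σ * ‖w‖ := by
    rw [← mul_pow] at hupper
    exact le_of_sq_le_sq hupper (by positivity)
  -- The bound passes from T* to T on its range: ‖w‖² = ⟨Tw, u⟩ ≤ ‖Tw‖ ‖u‖ and c‖u‖ ≤ ‖w‖.
  have hlower : c * ‖w‖ ≤ ‖T w‖ := by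
    have h1 : ‖w‖ ^ 2 ≤ ‖T w‖ * ‖u‖ := by
      have : ((‖w‖ ^ 2 : ℝ) : ℂ) = inner ℂ (T w) u := by
        rw [← LinearMap.adjoint_inner_right, ← hw, inner_self_eq_norm_sq_to_K]
        norm_cast
      calc ‖w‖ ^ 2 = ‖((‖w‖ ^ 2 : ℝ) : ℂ)‖ := by
            rw [Complex.norm_real, Real.norm_of_nonneg (by positivity)]
        _ ≤ ‖T w‖ * ‖u‖ := by rw [this]; exact norm_inner_le_norm _ _
    have h2 := mul_le_mul_of_nonneg_left h1 hc.le
    have h3 := mul_le_mul_of_nonneg_left (h u) (norm_nonneg (T w))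
    rw [← hw] at h3
    have h4 : (c * ‖w‖) * ‖w‖ ≤ ‖T w‖ * ‖w‖ := by nlinarith
    exact le_of_mul_le_mul_right h4 hwpos
  exact le_of_mul_le_mul_right (hlower.trans hTw) hwpos

theorem le_sigmaMin {m n : Type*} [Fintype m] [Fintype n] [DecidableEq n] [Nonempty m]
    (A : Matrix m n ℂ) {c : ℝ} (hc : 0 < c)
    (h : ∀ u : m → ℂ, c ^ 2 * ∑ j, ‖u j‖ ^ 2 ≤ ∑ ν, ‖∑ j, u j * star (A j ν)‖ ^ 2) :
    c ≤ sigmaMin A := by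
  classical
  have h' : ∀ u, c * ‖u‖ ≤ ‖LinearMap.adjoint (Matrix.toEuclideanLin A) u‖ := by
    intro u
    rw [← Matrix.toEuclideanLin_conjTranspose_eq_adjoint]
    refine le_of_sq_le_sq ?_ (norm_nonneg _)
    rw [mul_pow, EuclideanSpace.norm_sq_eq, EuclideanSpace.norm_sq_eq]
    refine (h u).trans_eq (Finset.sum_congr rfl fun ν _ => ?_)
    simp [Matrix.toLpLin_apply, Matrix.mulVec, dotProduct, mul_comm]
  have h1 := finrank_le_of_forall_mul_norm_le_norm_adjoint _ hc h'
  have h2 := le_singularValues_of_forall_mul_norm_le_norm_adjoint _ hc h'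
    (by rw [finrank_euclideanSpace]; exact Fintype.card_pos)
  rw [finrank_euclideanSpace, finrank_euclideanSpace] at h1
  rw [finrank_euclideanSpace] at h2
  rwa [sigmaMin, min_eq_left h1]

end SingularValues

/-! ### Compactly supported functions on the circle and their Fourier coefficients. -/

section Bump

open MeasureTheory Set

/-- The `1`-periodic function that agrees with `f` on `(-a, a)` and vanishes on the rest of
`(-1/2, 1/2]`. -/
noncomputable def bump (a : ℝ) (f : ℝ → ℂ) : UnitAddCircle → ℂ :=
  AddCircle.liftIoc 1 (-(1 / 2)) ((Ioo (-a) a).indicator f)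

variable {a : ℝ} {f : ℝ → ℂ}

theorem exists_coe_eq_bump_eq (a : ℝ) (f : ℝ → ℂ) (x : UnitAddCircle) :
    ∃ y : ℝ, (y : UnitAddCircle) = x ∧ bump a f x = (Ioo (-a) a).indicator f y := by
  refine ⟨AddCircle.equivIoc 1 (-(1 / 2)) x, ?_, rfl⟩
  exact (AddCircle.equivIoc 1 (-(1 / 2))).symm_apply_apply x

theorem norm_lt_of_bump_ne_zero {x : UnitAddCircle} (hx : bump a f x ≠ 0) : ‖x‖ < a := by
  obtain ⟨y, rfl, hy⟩ := exists_coe_eq_bump_eq a f x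
  rw [hy] at hx
  have hya : y ∈ Ioo (-a) a := mem_of_indicator_ne_zero hx
  have h := round_le y 0
  rw [UnitAddCircle.norm_eq]
  refine h.trans_lt ?_
  simpa using abs_lt.2 hya

theorem measurable_bump (hf : Continuous f) : Measurable (bump a f) := by
  have h : Measurable ((Ioo (-a) a).indicator f) := hf.measurable.indicator measurableSet_Ioo
  exact h.comp (measurable_subtype_coe.comp
    (AddCircle.measurableEquivIoc 1 (-(1 / 2))).measurable)

theorem exists_norm_bump_le (a : ℝ) (hf : Continuous f) : ∃ C, ∀ x, ‖bump a f x‖ ≤ C := by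
  obtain ⟨C, hC⟩ := (isCompact_Icc (a := -a) (b := a)).exists_bound_of_continuousOn hf.continuousOn
  refine ⟨max C 0, fun x => ?_⟩
  obtain ⟨y, -, hy⟩ := exists_coe_eq_bump_eq a f x
  rw [hy]
  by_cases h : y ∈ Ioo (-a) a
  · rw [indicator_of_mem h]
    exact (hC y (Ioo_subset_Icc_self h)).trans (le_max_left _ _)
  · rw [indicator_of_notMem h, norm_zero]
    exact le_max_right _ _

theorem integral_indicator_Ioo {E : Type*} [NormedAddCommGroup E] [NormedSpace ℝ E]
    (ha : 0 ≤ a) (ha' : a ≤ 1 / 2) (g : ℝ → E) :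
    ∫ x in (-(1 / 2) : ℝ)..(-(1 / 2) + 1), (Ioo (-a) a).indicator g x = ∫ x in (-a)..a, g x := by
  rw [intervalIntegral.integral_of_le (by norm_num), intervalIntegral.integral_of_le (by linarith),
    setIntegral_indicator measurableSet_Ioo, integral_Ioc_eq_integral_Ioo]
  congr 2
  rw [inter_eq_right]
  intro x hx
  constructor <;> linarith [hx.1, hx.2]

theorem integral_norm_sq_bump (ha : 0 ≤ a) (ha' : a ≤ 1 / 2) :
    ∫ x, ‖bump a f x‖ ^ 2 ∂AddCircle.haarAddCircle = ∫ x in (-a)..a, ‖f x‖ ^ 2 := by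
  rw [← integral_indicator_Ioo ha ha', AddCircle.integral_haarAddCircle, inv_one, one_smul,
    ← AddCircle.integral_liftIoc_eq_intervalIntegral]
  congr 1
  ext x
  simp only [bump, AddCircle.liftIoc, Function.comp_apply, domRestrict_apply]
  by_cases h : ((AddCircle.equivIoc 1 (-(1 / 2)) x : Ioc _ _) : ℝ) ∈ Ioo (-a) a
  · rw [indicator_of_mem h, indicator_of_mem h]
  · rw [indicator_of_notMem h, indicator_of_notMem h]
    simp

theorem fourierCoeff_bump (ha : 0 ≤ a) (ha' : a ≤ 1 / 2) (n : ℤ) :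
    fourierCoeff (bump a f) n
      = ∫ x in (-a)..a, Complex.exp (-(2 * Real.pi * Complex.I * n * x)) * f x := by
  rw [bump, fourierCoeff_liftIoc_eq, fourierCoeffOn_eq_integral, ← integral_indicator_Ioo ha ha']
  simp only [add_sub_cancel_left, div_one, one_smul]
  congr 1
  ext x
  by_cases h : x ∈ Ioo (-a) a
  · rw [indicator_of_mem h, indicator_of_mem h, fourier_coe_apply, smul_eq_mul]
    congr 2
    push_cast
    ring
  · rw [indicator_of_notMem h, indicator_of_notMem h, smul_zero]

end Bump

/-! ### Integration by parts for the polynomial test function. -/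

section Polynomial

open Polynomial intervalIntegral

variable {a : ℝ}

/-- Integration by parts against an exponential, without boundary terms. -/
theorem integral_exp_mul_derivative {P : ℝ[X]} (h₁ : P.eval a = 0) (h₂ : P.eval (-a) = 0) (w : ℂ) :
    ∫ x in (-a)..a, Complex.exp (-(w * x)) * (((derivative P).eval x : ℝ) : ℂ)
      = w * ∫ x in (-a)..a, Complex.exp (-(w * x)) * ((P.eval x : ℝ) : ℂ) := by
  have hu : ∀ x ∈ Set.uIcc (-a) a,
      HasDerivAt (fun x : ℝ => Complex.exp (-(w * x))) (Complex.exp (-(w * x)) * (-w)) x := by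
    intro x _
    have h : HasDerivAt (fun x : ℝ => -(w * (x : ℂ))) (-(w * 1)) x :=
      ((Complex.ofRealCLM.hasDerivAt (x := x)).const_mul w).neg
    rw [mul_one] at h
    exact h.cexp
  have hv : ∀ x ∈ Set.uIcc (-a) a,
      HasDerivAt (fun x : ℝ => ((P.eval x : ℝ) : ℂ)) (((derivative P).eval x : ℝ) : ℂ) x :=
    fun x _ => (P.hasDerivAt x).ofReal_comp
  rw [integral_mul_deriv_eq_deriv_mul hu hv (Continuous.intervalIntegrable (by fun_prop) _ _)
    (Continuous.intervalIntegrable (by fun_prop) _ _), h₁, h₂, ← integral_const_mul]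
  simp only [Complex.ofReal_zero, mul_zero, sub_zero, zero_sub, ← integral_neg]
  congr 1
  ext x
  ring

theorem integral_exp_mul_iterate_derivative {P : ℝ[X]} {p : ℕ}
    (h₁ : ∀ k < p, (derivative^[k] P).eval a = 0) (h₂ : ∀ k < p, (derivative^[k] P).eval (-a) = 0)
    (w : ℂ) :
    ∫ x in (-a)..a, Complex.exp (-(w * x)) * (((derivative^[p] P).eval x : ℝ) : ℂ)
      = w ^ p * ∫ x in (-a)..a, Complex.exp (-(w * x)) * ((P.eval x : ℝ) : ℂ) := by
  induction p with
  | zero => simp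
  | succ p ih =>
    rw [Function.iterate_succ_apply', integral_exp_mul_derivative (h₁ p (by omega))
      (h₂ p (by omega)), ih (fun k hk => h₁ k (by omega)) (fun k hk => h₂ k (by omega))]
    ring

theorem integral_iterate_derivative_mul_self {P : ℝ[X]} {p : ℕ}
    (h₁ : ∀ k < p, (derivative^[k] P).eval a = 0) (h₂ : ∀ k < p, (derivative^[k] P).eval (-a) = 0)
    {k : ℕ} (hk : k ≤ p) :
    ∫ x in (-a)..a, (derivative^[p] P).eval x * (derivative^[p] P).eval x
      = (-1) ^ k * ∫ x in (-a)..a, (derivative^[p + k] P).eval x * (derivative^[p - k] P).eval x := by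
  induction k with
  | zero => simp
  | succ k ih =>
    obtain ⟨j, rfl⟩ : ∃ j, p = j + (k + 1) := ⟨p - (k + 1), by omega⟩
    have e₁ : j + (k + 1) - k = j + 1 := by omega
    have e₂ : j + (k + 1) - (k + 1) = j := by omega
    rw [ih (by omega), e₁, e₂, Function.iterate_succ_apply',
      integral_mul_deriv_eq_deriv_mul (fun x _ => Polynomial.hasDerivAt _ x)
      (fun x _ => Polynomial.hasDerivAt _ x)
      (Continuous.intervalIntegrable (by fun_prop) _ _)
      (Continuous.intervalIntegrable (by fun_prop) _ _), h₁ j (by omega), h₂ j (by omega),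
      ← Function.iterate_succ_apply' (⇑derivative)]
    have e₃ : (j + (k + 1) + k).succ = j + (k + 1) + (k + 1) := by omega
    rw [e₃]
    ring

/-- The polynomial `(1 - (X / a) ^ 2) ^ p`, which vanishes to order `p` at `± a`. -/
noncomputable def bumpPoly (a : ℝ) (p : ℕ) : ℝ[X] := (1 - C (a⁻¹ ^ 2) * X ^ 2) ^ p

theorem eval_bumpPoly (a : ℝ) (p : ℕ) (x : ℝ) : (bumpPoly a p).eval x = (1 - (x / a) ^ 2) ^ p := by
  simp only [bumpPoly, eval_pow, eval_sub, eval_one, eval_mul, eval_C, eval_X]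
  ring

theorem eval_iterate_derivative_bumpPoly {p k : ℕ} (hk : k < p) {x : ℝ} (hx : (x / a) ^ 2 = 1) :
    (derivative^[k] (bumpPoly a p)).eval x = 0 := by
  obtain ⟨Q, hQ⟩ := pow_sub_dvd_iterate_derivative_pow (1 - C (a⁻¹ ^ 2) * X ^ 2 : ℝ[X]) p k
  have h0 : (1 - C (a⁻¹ ^ 2) * X ^ 2 : ℝ[X]).eval x = 0 := by
    have : a⁻¹ ^ 2 * x ^ 2 = 1 := by rw [← hx]; ring
    simp only [eval_sub, eval_one, eval_mul, eval_C, eval_pow, eval_X]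
    linarith
  rw [bumpPoly, hQ, eval_mul, eval_pow, h0, zero_pow (by omega), zero_mul]

/-- The degree is at most 2p, so only the X^{2p} coefficient (-a⁻²)^p survives. -/
theorem iterate_derivative_two_mul_bumpPoly (a : ℝ) (p : ℕ) :
    derivative^[p + p] (bumpPoly a p) = C ((-1) ^ p * ((2 * p).factorial * a⁻¹ ^ (2 * p))) := by
  have hdeg : (1 - C (a⁻¹ ^ 2) * X ^ 2 : ℝ[X]).natDegree ≤ 2 := by compute_degree
  have hdegp : (bumpPoly a p).natDegree ≤ p + p := by
    refine (natDegree_pow_le_of_le p hdeg).trans_eq (by ring)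
  have hc : (1 - C (a⁻¹ ^ 2) * X ^ 2 : ℝ[X]).coeff 2 = -(a⁻¹ ^ 2) := by
    simp only [coeff_sub, coeff_C_mul, coeff_X_pow, coeff_one]
    norm_num
  have h0 : (derivative^[p + p] (bumpPoly a p)).natDegree = 0 := by
    have := natDegree_iterate_derivative (bumpPoly a p) (p + p)
    omega
  rw [eq_C_of_natDegree_eq_zero h0, coeff_iterate_derivative, zero_add, ← two_mul,
    Nat.descFactorial_self, bumpPoly, mul_comm 2 p, coeff_pow_of_natDegree_le hdeg, hc,
    nsmul_eq_mul, neg_pow, ← pow_mul]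
  congr 1
  ring

/-- Moving p derivatives from one factor to the other leaves a constant times the polynomial itself;
the two signs (-1)^p cancel. -/
theorem integral_sq_iterate_derivative_bumpPoly (ha : a ≠ 0) (p : ℕ) :
    ∫ x in (-a)..a, (derivative^[p] (bumpPoly a p)).eval x ^ 2
      = (2 * p).factorial * a⁻¹ ^ (2 * p) * ∫ x in (-a)..a, (bumpPoly a p).eval x := by
  simp only [pow_two ((derivative^[p] (bumpPoly a p)).eval _)]
  rw [integral_iterate_derivative_mul_self
    (fun k hk => eval_iterate_derivative_bumpPoly hk (by field_simp))
    (fun k hk => eval_iterate_derivative_bumpPoly hk (by field_simp)) le_rfl,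
    iterate_derivative_two_mul_bumpPoly]
  simp only [eval_C, Nat.sub_self, Function.iterate_zero_apply, integral_const_mul]
  rw [← mul_assoc, ← mul_assoc, ← pow_add, ← two_mul, pow_mul (-1 : ℝ)]
  norm_num

end Polynomial

/-! ### Estimates for the integrals I_m. -/

section Moments

open MeasureTheory intervalIntegral

/-- The integral of `(1 - y ^ 2) ^ m` over `[-1, 1]`. -/
noncomputable def bumpInt (m : ℕ) : ℝ := ∫ y in (-1 : ℝ)..1, (1 - y ^ 2) ^ m

theorem integral_one_sub_div_sq_pow {a : ℝ} (ha : a ≠ 0) (m : ℕ) :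
    ∫ x in (-a)..a, (1 - (x / a) ^ 2) ^ m = a * bumpInt m := by
  rw [integral_comp_div (fun y => (1 - y ^ 2) ^ m) ha, neg_div, div_self ha, smul_eq_mul, bumpInt]

theorem bumpInt_pos (m : ℕ) : 0 < bumpInt m := by
  refine intervalIntegral_pos_of_pos_on (Continuous.intervalIntegrable (by fun_prop) _ _)
    (fun y hy => pow_pos ?_ m) (by norm_num)
  nlinarith [hy.1, hy.2]

/-- Rescaling by √2 turns 1 - y² into 1 - 2y² ≤ (1 - y²)². -/
theorem bumpInt_le_sqrt_two_mul (m : ℕ) : bumpInt m ≤ √2 * bumpInt (2 * m) := by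
  have hs : 0 < √2 := by positivity
  have hs2 : √2 ^ 2 = 2 := Real.sq_sqrt (by norm_num)
  have hs1 : (√2)⁻¹ ≤ 1 := inv_le_one_of_one_le₀ (Real.one_le_sqrt.2 (by norm_num))
  have hs0 : 0 < (√2)⁻¹ := by positivity
  rw [← inv_mul_le_iff₀ hs, ← integral_one_sub_div_sq_pow hs0.ne']
  have hsq : ∀ y : ℝ, (y / (√2)⁻¹) ^ 2 = 2 * y ^ 2 := by
    intro y
    rw [div_inv_eq_mul, mul_pow, hs2, mul_comm]
  simp only [hsq]
  have h1 : ∫ y in (-(√2)⁻¹)..(√2)⁻¹, (1 - 2 * y ^ 2) ^ m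
      ≤ ∫ y in (-(√2)⁻¹)..(√2)⁻¹, (1 - y ^ 2) ^ (2 * m) := by
    refine integral_mono_on (by linarith) (Continuous.intervalIntegrable (by fun_prop) _ _)
      (Continuous.intervalIntegrable (by fun_prop) _ _) fun y hy => ?_
    rw [pow_mul]
    refine pow_le_pow_left₀ ?_ (by nlinarith [sq_nonneg (y ^ 2)]) m
    have h2 : y ^ 2 ≤ (√2)⁻¹ ^ 2 := sq_le_sq' hy.1 hy.2
    rw [inv_pow, hs2] at h2
    linarith
  refine h1.trans (integral_mono_interval (by linarith) (by linarith) hs1 ?_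
    (Continuous.intervalIntegrable (by fun_prop) _ _))
  refine Filter.Eventually.of_forall fun y => ?_
  simp only [Pi.zero_apply, pow_mul]
  exact pow_nonneg (sq_nonneg _) _

/-- Comparison with the Gaussian integral through 1 - y² ≤ exp(-y²). -/
theorem bumpInt_le_sqrt_pi_div {m : ℕ} (hm : 0 < m) : bumpInt m ≤ √(Real.pi / m) := by
  have hm' : (0 : ℝ) < m := by exact_mod_cast hm
  rw [← integral_gaussian, bumpInt]
  have hint := integrable_exp_neg_mul_sq hm'
  refine (integral_mono_on (g := fun y => Real.exp (-m * y ^ 2)) (by norm_num)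
    (Continuous.intervalIntegrable (by fun_prop) _ _) hint.intervalIntegrable
    fun y hy => ?_).trans ?_
  · rw [neg_mul, ← mul_neg, Real.exp_nat_mul]
    refine pow_le_pow_left₀ (by nlinarith [hy.1, hy.2]) ?_ m
    linarith [Real.add_one_le_exp (-y ^ 2)]
  · rw [integral_of_le (by norm_num)]
    exact setIntegral_le_integral hint (Filter.Eventually.of_forall fun y => (Real.exp_pos _).le)

end Moments

/-! ### Parseval on the torus for disjoint translates. -/

section Torus

open MeasureTheory UnitAddTorus

/-- The measure on `ℝ / ℤ` of total mass `1`. -/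
noncomputable local instance instMeasureSpaceCircle : MeasureSpace UnitAddCircle := ⟨AddCircle.haarAddCircle⟩

local instance instIsAddHaarCircle : Measure.IsAddHaarMeasure (volume : Measure UnitAddCircle) :=
  inferInstanceAs (Measure.IsAddHaarMeasure AddCircle.haarAddCircle)

local instance instIsProbabilityCircle : IsProbabilityMeasure (volume : Measure UnitAddCircle) :=
  inferInstanceAs (IsProbabilityMeasure AddCircle.haarAddCircle)

theorem fourierCoeff_comp_sub (φ : UnitAddCircle → ℂ) (τ : UnitAddCircle) (n : ℤ) :
    ∫ x : UnitAddCircle, fourier (-n) x * φ (x - τ) = fourier (-n) τ * fourierCoeff φ n := by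
  rw [← integral_add_right_eq_self _ τ, fourierCoeff, ← integral_const_mul]
  congr 1
  ext x
  rw [add_sub_cancel_right, smul_eq_mul, ← mul_assoc]
  congr 1
  simp only [fourier_apply, smul_add, AddCircle.toCircle_add, Circle.coe_mul, mul_comm]

variable {ι : Type*} [Fintype ι]

theorem mFourierCoeff_prod_comp_sub (φ : ι → UnitAddCircle → ℂ) (τ : ι → UnitAddCircle)
    (ν : ι → ℤ) :
    mFourierCoeff (fun x => ∏ s, φ s (x s - τ s)) ν
      = (∏ s, fourier (-ν s) (τ s)) * ∏ s, fourierCoeff (φ s) (ν s) := by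
  have h : ∀ x : UnitAddTorus ι, mFourier (-ν) x • ∏ s, φ s (x s - τ s)
      = ∏ s, (fourier (-ν s) (x s) * φ s (x s - τ s)) := by
    intro x
    rw [smul_eq_mul, Finset.prod_mul_distrib]
    rfl
  simp only [mFourierCoeff, h]
  rw [← Finset.prod_mul_distrib,
    integral_fintype_prod_volume_eq_prod fun s y => fourier (-ν s) y * φ s (y - τ s)]
  exact Finset.prod_congr rfl fun s _ => fourierCoeff_comp_sub _ _ _

theorem integral_norm_sq_prod_comp_sub (φ : ι → UnitAddCircle → ℂ) (τ : ι → UnitAddCircle) :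
    ∫ x : UnitAddTorus ι, ‖∏ s, φ s (x s - τ s)‖ ^ 2
      = ∏ s, ∫ x, ‖φ s x‖ ^ 2 ∂AddCircle.haarAddCircle := by
  simp only [norm_prod, ← Finset.prod_pow]
  rw [integral_fintype_prod_volume_eq_prod fun s y => ‖φ s (y - τ s)‖ ^ 2]
  refine Finset.prod_congr rfl fun s _ => ?_
  exact integral_sub_right_eq_self (fun y => ‖φ s y‖ ^ 2) (τ s)

variable {κ : Type*} [Fintype κ]

theorem norm_sq_sum_of_disjoint (u G : κ → ℂ) (h : ∀ j k, j ≠ k → G j ≠ 0 → G k = 0) :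
    ‖∑ j, u j * G j‖ ^ 2 = ∑ j, ‖u j‖ ^ 2 * ‖G j‖ ^ 2 := by
  by_cases hG : ∃ j, G j ≠ 0
  · obtain ⟨j, hj⟩ := hG
    rw [Fintype.sum_eq_single j, Fintype.sum_eq_single j, norm_mul, mul_pow]
    · intro k hk
      rw [h j k hk.symm hj]
      simp
    · intro k hk
      rw [h j k hk.symm hj, mul_zero]
  · push Not at hG
    simp [hG]

/-- **Parseval's identity** for a combination of translates, with disjoint supports, of a product
function on the torus. -/
theorem hasSum_norm_sq_translates {a : ℝ} (ha : 0 < a) {φ : ι → UnitAddCircle → ℂ}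
    (hmeas : ∀ s, Measurable (φ s)) (hbound : ∀ s, ∃ C, ∀ x, ‖φ s x‖ ≤ C)
    (hsupp : ∀ s x, φ s x ≠ 0 → ‖x‖ < a) {t : κ → ι → UnitAddCircle}
    (ht : ∀ j k, j ≠ k → 2 * a ≤ dist (t j) (t k)) (u : κ → ℂ) :
    HasSum (fun ν : ι → ℤ => ‖∑ j, u j * ∏ s, (fourier (-ν s) (t j s) : ℂ)‖ ^ 2 *
        ∏ s, ‖fourierCoeff (φ s) (ν s)‖ ^ 2)
      ((∑ j, ‖u j‖ ^ 2) * ∏ s, ∫ x, ‖φ s x‖ ^ 2 ∂AddCircle.haarAddCircle) := by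
  set G : κ → UnitAddTorus ι → ℂ := fun j x => ∏ s, φ s (x s - t j s) with hG
  have hGmeas : ∀ j, Measurable (G j) := fun j =>
    Finset.measurable_prod _ fun s _ => (hmeas s).comp ((measurable_pi_apply s).sub_const _)
  choose C hC using hbound
  have hGbound : ∀ j x, ‖G j x‖ ≤ ∏ s, C s := by
    intro j x
    rw [hG, norm_prod]
    exact Finset.prod_le_prod (fun s _ => norm_nonneg _) fun s _ => hC s _
  have hGL : ∀ j (p : ℝ≥0∞), MemLp (G j) p := fun j p =>
    MemLp.of_bound (hGmeas j).aestronglyMeasurable _ (Filter.Eventually.of_forall (hGbound j))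
  have hF : MemLp (fun x => ∑ j, u j * G j x) 2 :=
    memLp_finsetSum _ fun j _ => (hGL j 2).const_mul (u j)
  -- If two translates were nonzero at x, both nodes would be within a of x in every coordinate,
  -- hence at sup-distance less than 2a.
  have hdisj : ∀ x j k, j ≠ k → G j x ≠ 0 → G k x = 0 := by
    intro x j k hjk hj
    by_contra hk
    rw [hG, Finset.prod_ne_zero_iff] at hj
    have hk' : ∏ s, φ s (x s - t k s) ≠ 0 := hk
    rw [Finset.prod_ne_zero_iff] at hk'
    refine (ht j k hjk).not_gt ((dist_pi_lt_iff (by linarith)).2 fun s => ?_)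
    have h1 := hsupp s _ (hj s (Finset.mem_univ s))
    have h2 := hsupp s _ (hk' s (Finset.mem_univ s))
    rw [← dist_eq_norm] at h1 h2
    have h3 := dist_triangle_left (t j s) (t k s) (x s)
    linarith
  have hcoeff : ∀ ν, mFourierCoeff hF.toLp ν
      = (∑ j, u j * ∏ s, (fourier (-ν s) (t j s) : ℂ)) * ∏ s, fourierCoeff (φ s) (ν s) := by
    intro ν
    have h1 : mFourierCoeff hF.toLp ν = ∫ x, ∑ j, u j * (mFourier (-ν) x • G j x) := by
      refine integral_congr_ae ?_
      filter_upwards [hF.coeFn_toLp] with x hx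
      rw [hx, smul_eq_mul, Finset.mul_sum]
      refine Finset.sum_congr rfl fun j _ => ?_
      rw [smul_eq_mul]
      ring
    rw [h1, integral_finsetSum, Finset.sum_mul]
    · refine Finset.sum_congr rfl fun j _ => ?_
      rw [integral_const_mul, mul_assoc, ← mFourierCoeff_prod_comp_sub]
      rfl
    · intro j _
      refine Integrable.const_mul ?_ _
      refine (memLp_one_iff_integrable.1 (hGL j 1)).bdd_mul (c := 1)
        (mFourier (-ν)).continuous.aestronglyMeasurable (Filter.Eventually.of_forall fun x => ?_)
      exact ((mFourier (-ν)).norm_coe_le_norm x).trans_eq mFourier_norm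
  have hP := hasSum_sq_mFourierCoeff hF.toLp
  simp only [hcoeff, norm_mul, norm_prod, mul_pow, ← Finset.prod_pow] at hP
  convert hP using 1
  have h2 : ∫ x, ‖(hF.toLp _) x‖ ^ 2 = ∫ x, ∑ j, ‖u j‖ ^ 2 * ‖G j x‖ ^ 2 := by
    refine integral_congr_ae ?_
    filter_upwards [hF.coeFn_toLp] with x hx
    rw [hx]
    exact norm_sq_sum_of_disjoint u (fun j => G j x) (hdisj x)
  rw [h2, integral_finsetSum, Finset.sum_mul]
  · refine Finset.sum_congr rfl fun j _ => ?_
    rw [integral_const_mul, hG, integral_norm_sq_prod_comp_sub]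
  · intro j _
    exact ((hGL j 2).integrable_norm_pow (by norm_num)).const_mul _

end Torus

/-! ### A weight that is nonpositive outside the frequency box. -/

section Minorant

theorem star_vandermonde_apply {d M : ℕ} (N : ℕ) (t : Fin M → Fin d → UnitAddCircle) (j : Fin M)
    (ν : Fin d → Fin N) :
    star (vandermonde N t j ν) = ∏ s, (fourier (-((ν s : ℕ) : ℤ)) (t j s) : ℂ) := by
  simp only [vandermonde, Matrix.of_apply, star_prod]
  refine Finset.prod_congr rfl fun s _ => ?_
  rw [fourier_neg, fourier_apply, AddCircle.toCircle_zsmul, Circle.coe_zpow, zpow_natCast]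
  rfl

theorem exists_le_abs_sub_of_notMem_box {d N : ℕ} {ν : Fin d → ℤ}
    (hν : ¬ ∃ μ : Fin d → Fin N, (fun s => ((μ s : ℕ) : ℤ)) = ν) :
    ∃ s, ((N : ℝ) - 1) / 2 ≤ |(ν s : ℝ) - ((N : ℝ) - 1) / 2| := by
  by_contra! h
  refine hν ⟨fun s => ⟨(ν s).toNat, ?_⟩, ?_⟩
  all_goals
    have h0 : ∀ s, 0 ≤ ν s ∧ ν s < N := by
      intro s
      obtain ⟨h1, h2⟩ := abs_lt.1 (h s)
      have h3 : (0 : ℝ) < ν s := by linarith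
      have h4 : (ν s : ℝ) < N := by linarith
      exact ⟨by exact_mod_cast h3.le, by exact_mod_cast h4⟩
  · have := h0 s
    omega
  · ext s
    simpa using (h0 s).1

/-- Comparison of the box `{0, …, N - 1} ^ d` with the weight
`(π (N - 1)) ^ (2 p) - ∑ s, (2 π (ν s - (N - 1) / 2)) ^ (2 p)`, which is negative outside of it. -/
theorem le_sum_box_of_fourierCoeff {d M N p : ℕ} {a K : ℝ} (ha : 0 < a)
    {φ ψ : UnitAddCircle → ℂ} (hφ : Measurable φ) (hψ : Measurable ψ)
    (hφb : ∃ C, ∀ x, ‖φ x‖ ≤ C) (hψb : ∃ C, ∀ x, ‖ψ x‖ ≤ C)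
    (hφs : ∀ x, φ x ≠ 0 → ‖x‖ < a) (hψs : ∀ x, ψ x ≠ 0 → ‖x‖ < a)
    (hcoeff : ∀ n : ℤ, ‖fourierCoeff ψ n‖ ^ 2
      = (2 * Real.pi * (n - ((N : ℝ) - 1) / 2)) ^ (2 * p) * ‖fourierCoeff φ n‖ ^ 2)
    (hK : ∀ n, ‖fourierCoeff φ n‖ ≤ K)
    {t : Fin M → Fin d → UnitAddCircle} (ht : ∀ j k, j ≠ k → 2 * a ≤ dist (t j) (t k))
    (hN : 1 ≤ N) (u : Fin M → ℂ) :
    (∑ j, ‖u j‖ ^ 2) *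
        ((Real.pi * ((N : ℝ) - 1)) ^ (2 * p) * (∫ x, ‖φ x‖ ^ 2 ∂AddCircle.haarAddCircle) ^ d
          - d * ((∫ x, ‖ψ x‖ ^ 2 ∂AddCircle.haarAddCircle) *
            (∫ x, ‖φ x‖ ^ 2 ∂AddCircle.haarAddCircle) ^ (d - 1)))
      ≤ (Real.pi * ((N : ℝ) - 1)) ^ (2 * p) * (K ^ 2) ^ d *
        ∑ ν, ‖∑ j, u j * star (vandermonde N t j ν)‖ ^ 2 := by
  set R := (Real.pi * ((N : ℝ) - 1)) ^ (2 * p) with hR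
  have hN' : (0 : ℝ) ≤ (N : ℝ) - 1 := by
    have : (1 : ℝ) ≤ N := by exact_mod_cast hN
    linarith
  have hR0 : 0 ≤ R := by
    have := Real.pi_pos
    positivity
  set A := ∫ x, ‖φ x‖ ^ 2 ∂AddCircle.haarAddCircle
  set B := ∫ x, ‖ψ x‖ ^ 2 ∂AddCircle.haarAddCircle
  set w : ℤ → ℝ := fun n => (2 * Real.pi * (n - ((N : ℝ) - 1) / 2)) ^ (2 * p) with hw
  have hw0 : ∀ n, 0 ≤ w n := fun n => (even_two_mul p).pow_nonneg _
  set S : (Fin d → ℤ) → ℝ := fun ν => ‖∑ j, u j * ∏ s, (fourier (-ν s) (t j s) : ℂ)‖ ^ 2 *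
    ∏ s, ‖fourierCoeff φ (ν s)‖ ^ 2 with hS
  have hS0 : ∀ ν, 0 ≤ S ν := fun ν => by positivity
  have h0 : HasSum S ((∑ j, ‖u j‖ ^ 2) * A ^ d) := by
    have := hasSum_norm_sq_translates ha (φ := fun _ => φ) (fun _ => hφ) (fun _ => hφb)
      (fun _ => hφs) ht u
    simpa only [Finset.prod_const, Finset.card_univ, Fintype.card_fin] using this
  -- Parseval with ψ in place of φ in coordinate s only; by `hcoeff` this multiplies the term at ν
  -- by `w (ν s)`.
  have hs : ∀ s : Fin d, HasSum (fun ν => w (ν s) * S ν)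
      ((∑ j, ‖u j‖ ^ 2) * (B * A ^ (d - 1))) := by
    intro s
    have h1 : ∀ r, Function.update (fun _ : Fin d => φ) s ψ r = φ ∨
        Function.update (fun _ : Fin d => φ) s ψ r = ψ := by
      intro r
      rcases eq_or_ne r s with rfl | h
      · simp
      · simp [Function.update_of_ne h]
    have h2 := hasSum_norm_sq_translates ha (φ := Function.update (fun _ : Fin d => φ) s ψ)
      (fun r => by rcases h1 r with h | h <;> rwa [h])
      (fun r => by rcases h1 r with h | h <;> rwa [h])
      (fun r => by rcases h1 r with h | h <;> rwa [h]) ht u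
    have h3 : ∀ F : (UnitAddCircle → ℂ) → Fin d → ℝ,
        ∏ r, F (Function.update (fun _ : Fin d => φ) s ψ r) r
          = F ψ s * ∏ r ∈ Finset.univ.erase s, F φ r := by
      intro F
      rw [← Finset.mul_prod_erase _ _ (Finset.mem_univ s), Function.update_self]
      congr 1
      refine Finset.prod_congr rfl fun r hr => ?_
      rw [Function.update_of_ne (Finset.ne_of_mem_erase hr)]
    rw [h3 fun f _ => ∫ x, ‖f x‖ ^ 2 ∂AddCircle.haarAddCircle, Finset.prod_const,
      Finset.card_erase_of_mem (Finset.mem_univ s), Finset.card_univ, Fintype.card_fin] at h2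
    convert h2 using 1
    ext ν
    rw [h3 fun f r => ‖fourierCoeff f (ν r)‖ ^ 2, hcoeff, mul_assoc (_ ^ (2 * p)),
      Finset.mul_prod_erase _ (fun r => ‖fourierCoeff φ (ν r)‖ ^ 2) (Finset.mem_univ s)]
    simp only [hw, hS]
    ring
  -- The sign is reversed so that the terms off the box are nonnegative, as `sum_le_hasSum` needs.
  have hsum : HasSum (fun ν => -((R - ∑ s, w (ν s)) * S ν))
      (-((∑ j, ‖u j‖ ^ 2) * (R * A ^ d - d * (B * A ^ (d - 1))))) := by
    have h1 : (fun ν => -((R - ∑ s, w (ν s)) * S ν))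
        = fun ν => -(R * S ν - ∑ s, w (ν s) * S ν) := by
      ext ν
      rw [sub_mul, Finset.sum_mul]
    have h2 : (∑ j, ‖u j‖ ^ 2) * (R * A ^ d - d * (B * A ^ (d - 1)))
        = R * ((∑ j, ‖u j‖ ^ 2) * A ^ d)
          - ∑ _s : Fin d, (∑ j, ‖u j‖ ^ 2) * (B * A ^ (d - 1)) := by
      rw [Finset.sum_const, Finset.card_univ, Fintype.card_fin, nsmul_eq_mul]
      ring
    rw [h1, h2]
    exact ((h0.mul_left R).sub (hasSum_sum fun s (_ : s ∈ Finset.univ) => hs s)).neg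
  let e : (Fin d → Fin N) ↪ (Fin d → ℤ) := ⟨fun ν s => ((ν s : ℕ) : ℤ), fun μ ν h => by
    ext s
    have : ((μ s : ℕ) : ℤ) = ((ν s : ℕ) : ℤ) := congrFun h s
    exact_mod_cast this⟩
  have hout : ∀ ν ∉ Finset.univ.map e, 0 ≤ -((R - ∑ s, w (ν s)) * S ν) := by
    intro ν hν
    obtain ⟨s, hs⟩ := exists_le_abs_sub_of_notMem_box (N := N) (ν := ν)
      fun ⟨μ, hμ⟩ => hν (Finset.mem_map.2 ⟨μ, Finset.mem_univ μ, hμ⟩)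
    have h1 : R ≤ w (ν s) := by
      have h3 : Real.pi * ((N : ℝ) - 1) ≤ |2 * Real.pi * (ν s - ((N : ℝ) - 1) / 2)| := by
        rw [abs_mul, abs_of_pos Real.two_pi_pos]
        have := mul_le_mul_of_nonneg_left hs Real.two_pi_pos.le
        linarith
      have h4 := pow_le_pow_left₀ (mul_nonneg Real.pi_pos.le hN') h3 (2 * p)
      rwa [pow_abs_two_mul] at h4
    have h2 := Finset.single_le_sum (fun r _ => hw0 (ν r)) (Finset.mem_univ s)
    nlinarith [hS0 ν]
  have h1 := sum_le_hasSum _ hout hsum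
  rw [Finset.sum_neg_distrib, neg_le_neg_iff, Finset.sum_map] at h1
  refine h1.trans ?_
  rw [Finset.mul_sum]
  refine Finset.sum_le_sum fun ν _ => ?_
  have h2 : (R - ∑ s, w (e ν s)) * S (e ν) ≤ R * S (e ν) := by
    have := Finset.sum_nonneg fun s (_ : s ∈ Finset.univ) => hw0 (e ν s)
    exact mul_le_mul_of_nonneg_right (by linarith) (hS0 _)
  refine h2.trans ?_
  rw [mul_assoc]
  refine mul_le_mul_of_nonneg_left ?_ hR0
  simp only [star_vandermonde_apply, hS]
  rw [mul_comm]
  refine mul_le_mul_of_nonneg_right ?_ (by positivity)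
  refine (Finset.prod_le_prod (fun s _ => by positivity) fun s _ =>
    pow_le_pow_left₀ (norm_nonneg _) (hK _) 2).trans_eq ?_
  simp

end Minorant

/-! ### The frame bound for the explicit test function. -/

section Frame

open Polynomial

/-- The polynomial `P` modulated to the frequency `ρ`. -/
noncomputable def modulated (ρ : ℝ) (P : ℝ[X]) (x : ℝ) : ℂ :=
  Complex.exp (2 * Real.pi * Complex.I * ρ * x) * ((P.eval x : ℝ) : ℂ)

theorem continuous_modulated (ρ : ℝ) (P : ℝ[X]) : Continuous (modulated ρ P) := by
  unfold modulated
  fun_prop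

theorem norm_modulated (ρ : ℝ) (P : ℝ[X]) (x : ℝ) : ‖modulated ρ P x‖ = |P.eval x| := by
  have : 2 * Real.pi * Complex.I * ρ * x = ((2 * Real.pi * ρ * x : ℝ) : ℂ) * Complex.I := by
    push_cast
    ring
  rw [modulated, norm_mul, this, Complex.norm_exp_ofReal_mul_I, one_mul, Complex.norm_real,
    Real.norm_eq_abs]

theorem fourierCoeff_bump_modulated {a : ℝ} (ha : 0 ≤ a) (ha' : a ≤ 1 / 2) (ρ : ℝ) (P : ℝ[X])
    (n : ℤ) :
    fourierCoeff (bump a (modulated ρ P)) n = ∫ x in (-a)..a,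
      Complex.exp (-(((2 * Real.pi * (n - ρ) : ℝ) * Complex.I : ℂ) * x)) *
        ((P.eval x : ℝ) : ℂ) := by
  rw [fourierCoeff_bump ha ha']
  congr 1
  ext x
  rw [modulated, ← mul_assoc, ← Complex.exp_add]
  congr 2
  push_cast
  ring

/-- Frame-type lower bound for nodes of separation `2 a`, coming from the test function
`(1 - (x / a) ^ 2) ^ p`. -/
theorem le_sum_box {d M N p : ℕ} {a : ℝ} (ha : 0 < a) (ha' : a ≤ 1 / 2)
    {t : Fin M → Fin d → UnitAddCircle} (ht : ∀ j k, j ≠ k → 2 * a ≤ dist (t j) (t k))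
    (hN : 1 ≤ N) (u : Fin M → ℂ) :
    (∑ j, ‖u j‖ ^ 2) * ((Real.pi * ((N : ℝ) - 1)) ^ (2 * p) * (a * bumpInt (2 * p)) ^ d
          - d * ((2 * p).factorial * a⁻¹ ^ (2 * p) * (a * bumpInt p) *
            (a * bumpInt (2 * p)) ^ (d - 1)))
      ≤ (Real.pi * ((N : ℝ) - 1)) ^ (2 * p) * ((a * bumpInt p) ^ 2) ^ d *
        ∑ ν, ‖∑ j, u j * star (vandermonde N t j ν)‖ ^ 2 := by
  set ρ := ((N : ℝ) - 1) / 2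
  have hP := integral_one_sub_div_sq_pow ha.ne'
  have hint : ∀ P : ℝ[X], ∫ x, ‖bump a (modulated ρ P) x‖ ^ 2 ∂AddCircle.haarAddCircle
      = ∫ x in (-a)..a, P.eval x ^ 2 := by
    intro P
    rw [integral_norm_sq_bump ha.le ha']
    simp only [norm_modulated, sq_abs]
  have hA : ∫ x, ‖bump a (modulated ρ (bumpPoly a p)) x‖ ^ 2 ∂AddCircle.haarAddCircle
      = a * bumpInt (2 * p) := by
    rw [hint, ← hP]
    simp only [eval_bumpPoly, ← pow_mul, mul_comm p 2]
  have hB : ∫ x, ‖bump a (modulated ρ (derivative^[p] (bumpPoly a p))) x‖ ^ 2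
      ∂AddCircle.haarAddCircle = (2 * p).factorial * a⁻¹ ^ (2 * p) * (a * bumpInt p) := by
    rw [hint, integral_sq_iterate_derivative_bumpPoly ha.ne', ← hP]
    simp only [eval_bumpPoly]
  rw [← hA, ← hB]
  refine le_sum_box_of_fourierCoeff ha (measurable_bump (continuous_modulated _ _))
    (measurable_bump (continuous_modulated _ _))
    (exists_norm_bump_le a (continuous_modulated _ _))
    (exists_norm_bump_le a (continuous_modulated _ _))
    (fun x => norm_lt_of_bump_ne_zero) (fun x => norm_lt_of_bump_ne_zero) ?_ ?_ ht hN u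
  · intro n
    rw [fourierCoeff_bump_modulated ha.le ha', fourierCoeff_bump_modulated ha.le ha',
      integral_exp_mul_iterate_derivative
        (fun k hk => eval_iterate_derivative_bumpPoly hk (by field_simp))
        (fun k hk => eval_iterate_derivative_bumpPoly hk (by field_simp)),
      norm_mul, mul_pow, norm_pow, norm_mul, Complex.norm_I, mul_one, Complex.norm_real,
      Real.norm_eq_abs, ← pow_mul, mul_comm p 2, pow_abs_two_mul]
  -- K is the L¹ norm of the test function, which bounds every Fourier coefficient.
  · intro n
    rw [fourierCoeff_bump ha.le ha', ← hP]
    refine intervalIntegral.norm_integral_le_of_norm_le (by linarith)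
      (Filter.Eventually.of_forall fun x hx => ?_) (Continuous.intervalIntegrable (by fun_prop) _ _)
    have h1 : -(2 * Real.pi * Complex.I * n * x) = ((-(2 * Real.pi * n * x) : ℝ) : ℂ) * Complex.I := by
      push_cast
      ring
    rw [norm_mul, h1, Complex.norm_exp_ofReal_mul_I, one_mul, norm_modulated, eval_bumpPoly,
      abs_of_nonneg]
    refine pow_nonneg ?_ p
    have h2 : |x / a| ≤ 1 := by
      rw [abs_div, abs_of_pos ha, div_le_one ha]
      exact abs_le.2 ⟨hx.1.le, hx.2⟩
    have h3 := (sq_le_one_iff_abs_le_one _).2 h2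
    linarith

end Frame

/-! ### Numerical estimates for p = ⌈log d⌉ + 1. -/

section Constants

/-- With r = ⌈log d⌉, both 2√2 and e are below 9/2, so 2√2·d ≤ (9/2)^{r+1}. Also (2(r+1))! ≤
(2(r+1)²)^{r+1}. The product is (3(r+1))^{2(r+1)}, and 3(r+1) ≤ 3 log d + 6. -/
theorem two_sqrt_two_mul_factorial_le {d : ℕ} (hd : 1 ≤ d) :
    2 * √2 * d * (2 * (⌈Real.log d⌉₊ + 1)).factorial
      ≤ (4 * Real.log d + 7) ^ (2 * (⌈Real.log d⌉₊ + 1)) := by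
  have hd' : (1 : ℝ) ≤ d := by exact_mod_cast hd
  have hlog : 0 ≤ Real.log d := Real.log_nonneg hd'
  have hceil := Nat.ceil_lt_add_one hlog
  have hle := Nat.le_ceil (Real.log d)
  set r := ⌈Real.log d⌉₊
  have hr0 : (0 : ℝ) ≤ r := Nat.cast_nonneg r
  have h2 : 2 * √2 ≤ 9 / 2 := by
    nlinarith [Real.sq_sqrt (show (0 : ℝ) ≤ 2 by norm_num), Real.sqrt_nonneg 2]
  have h1 : (d : ℝ) ≤ (9 / 2) ^ r := by
    calc (d : ℝ) = Real.exp (Real.log d) := (Real.exp_log (by linarith)).symm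
      _ ≤ Real.exp (r * 1) := Real.exp_le_exp.2 (by linarith)
      _ = Real.exp 1 ^ r := Real.exp_nat_mul 1 r
      _ ≤ (9 / 2) ^ r :=
        pow_le_pow_left₀ (Real.exp_pos 1).le (by linarith [Real.exp_one_lt_d9]) r
  have h3 : ((2 * (r + 1)).factorial : ℝ) ≤ (2 * ((r : ℝ) + 1) ^ 2) ^ (r + 1) := by
    have h4 : (2 * (r + 1)).factorial ≤ (2 * (r + 1)) ^ (r + 1) * (r + 1) ^ (r + 1) :=
      (Nat.factorial_two_mul_le (r + 1)).trans
        (Nat.mul_le_mul_left _ (Nat.factorial_le_pow (r + 1)))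
    have h5 : ((2 * (r + 1)).factorial : ℝ)
        ≤ ((2 * (r + 1)) ^ (r + 1) * (r + 1) ^ (r + 1) : ℕ) := by exact_mod_cast h4
    refine h5.trans_eq ?_
    push_cast
    rw [← mul_pow]
    ring
  calc 2 * √2 * d * (2 * (r + 1)).factorial
      ≤ 9 / 2 * (9 / 2) ^ r * (2 * ((r : ℝ) + 1) ^ 2) ^ (r + 1) := by gcongr
    _ = ((3 * ((r : ℝ) + 1)) ^ 2) ^ (r + 1) := by
        rw [← pow_succ', ← mul_pow]
        ring
    _ ≤ ((4 * Real.log d + 7) ^ 2) ^ (r + 1) := by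
        gcongr
        linarith
    _ = (4 * Real.log d + 7) ^ (2 * (r + 1)) := by rw [← pow_mul]

theorem const_le_bumpInt_ratio {d : ℕ} (hd : 1 ≤ d) :
    √2 / (3 * Real.exp 1 ^ 2) * (1 / √(Real.log d + 1)) * (4 * Real.log d + 7) / Real.pi *
        bumpInt (⌈Real.log d⌉₊ + 1) ^ 2 ≤ bumpInt (2 * (⌈Real.log d⌉₊ + 1)) := by
  have hd' : (1 : ℝ) ≤ d := by exact_mod_cast hd
  have hlog : 0 ≤ Real.log d := Real.log_nonneg hd'
  have hle := Nat.le_ceil (Real.log d)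
  set p := ⌈Real.log d⌉₊ + 1 with hp
  have hpl : Real.log d + 1 ≤ p := by
    rw [hp]
    push_cast
    linarith
  set l := Real.log d + 1 with hl
  have hl1 : 1 ≤ l := by linarith
  have hI := bumpInt_pos p
  have hsl : 0 < √l := Real.sqrt_pos.2 (by linarith)
  have hsl2 : √l ^ 2 = l := Real.sq_sqrt (by linarith)
  have hI1 : bumpInt p ≤ √Real.pi / √l := by
    refine (bumpInt_le_sqrt_pi_div (by omega)).trans ?_
    rw [← Real.sqrt_div Real.pi_pos.le]
    exact Real.sqrt_le_sqrt (div_le_div_of_nonneg_left Real.pi_pos.le (by linarith) hpl)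
  have hI2 := bumpInt_le_sqrt_two_mul p
  have he : 7 ≤ Real.exp 1 ^ 2 := by nlinarith [Real.exp_one_gt_d9]
  have hpi : √Real.pi ^ 2 = Real.pi := Real.sq_sqrt Real.pi_pos.le
  have hpi1 : 1 ≤ √Real.pi := Real.one_le_sqrt.2 (by linarith [Real.pi_gt_three])
  have hs2 : √2 ^ 2 = 2 := Real.sq_sqrt (by norm_num)
  have hs : 0 < √2 := by positivity
  have hΛ : 4 * Real.log d + 7 ≤ 7 * l := by linarith
  -- Here e² ≥ 7 absorbs the 7 in 4 log d + 7 ≤ 7l, and the Gaussian bound supplies the second 1/√l.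
  have key : √2 / (3 * Real.exp 1 ^ 2) * (1 / √l) * (4 * Real.log d + 7) / Real.pi * bumpInt p
      ≤ 1 / √2 := by
    calc √2 / (3 * Real.exp 1 ^ 2) * (1 / √l) * (4 * Real.log d + 7) / Real.pi * bumpInt p
        ≤ √2 / (3 * 7) * (1 / √l) * (7 * l) / Real.pi * (√Real.pi / √l) := by
          have := Real.pi_pos
          gcongr
      _ = √2 / 3 / √Real.pi := by
          rw [← hpi, ← hsl2]
          field_simp
          norm_num
      _ ≤ √2 / 3 / 1 := by gcongr
      _ ≤ 1 / √2 := by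
          rw [le_div_iff₀ hs]
          nlinarith
  calc √2 / (3 * Real.exp 1 ^ 2) * (1 / √l) * (4 * Real.log d + 7) / Real.pi * bumpInt p ^ 2
      = √2 / (3 * Real.exp 1 ^ 2) * (1 / √l) * (4 * Real.log d + 7) / Real.pi * bumpInt p
        * bumpInt p := by ring
    _ ≤ 1 / √2 * (√2 * bumpInt (2 * p)) := by gcongr
    _ = bumpInt (2 * p) := by field_simp

end Constants

/-! ### From the separation hypothesis to pairwise distances. -/

section Separation

theorem le_dist_of_le_minSep {d M : ℕ} {n : ℕ} (hn : 0 < n) {L : ℝ}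
    {t : Fin M → Fin d → UnitAddCircle} (ht : Function.Injective t)
    (hsep : ENNReal.ofReal L ≤ minSep t * (n : ℝ≥0∞)) {j k : Fin M} (hjk : j ≠ k) :
    L / n ≤ dist (t j) (t k) := by
  have h1 : minSep t ≤ edist (t j) (t k) :=
    Set.einfsep_le_edist_of_mem (Set.mem_range_self j) (Set.mem_range_self k) (ht.ne hjk)
  have h2 := hsep.trans (mul_le_mul_left h1 _)
  rw [edist_dist, ← ENNReal.ofReal_natCast, ← ENNReal.ofReal_mul dist_nonneg,
    ENNReal.ofReal_le_ofReal_iff (by positivity)] at h2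
  rwa [div_le_iff₀ (by exact_mod_cast hn)]

theorem dist_torus_le_half {d : ℕ} (x y : Fin d → UnitAddCircle) : dist x y ≤ 1 / 2 := by
  refine (dist_pi_le_iff (by norm_num)).2 fun s => ?_
  rw [dist_eq_norm]
  simpa using AddCircle.norm_le_half_period (1 : ℝ) one_ne_zero (x := x s - y s)

end Separation

/-! ### Assembly of the bound. -/

section Main

theorem sq_const_mul_rpow {κ n : ℝ} (hκ : 0 ≤ κ) (hn : 0 ≤ n) (d : ℕ) :
    (1 / √2 * κ ^ ((d : ℝ) / 2) * n ^ ((d : ℝ) / 2)) ^ 2 = (κ * n) ^ d / 2 := by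
  have h : ∀ x : ℝ, 0 ≤ x → (x ^ ((d : ℝ) / 2)) ^ 2 = x ^ d := by
    intro x hx
    rw [← Real.rpow_natCast, ← Real.rpow_mul hx]
    simp
  rw [mul_pow, mul_pow, h κ hκ, h n hn, div_pow, Real.sq_sqrt (by norm_num), mul_pow]
  ring

/-- Lower bound for the quadratic form of the Vandermonde matrix of `2 a`-separated nodes, where
`a = (4 log d + 7) / (π (N - 1))`. -/
theorem half_pow_mul_sum_le {d M N : ℕ} (hd : 1 ≤ d) (hN : 1 < N)
    {t : Fin M → Fin d → UnitAddCircle}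
    (ha' : (4 * Real.log d + 7) / (Real.pi * ((N : ℝ) - 1)) ≤ 1 / 2)
    (ht : ∀ j k, j ≠ k → 2 * ((4 * Real.log d + 7) / (Real.pi * ((N : ℝ) - 1))) ≤ dist (t j) (t k))
    (u : Fin M → ℂ) :
    (√2 / (3 * Real.exp 1 ^ 2) * (1 / √(Real.log d + 1)) * ((N : ℝ) - 1)) ^ d / 2 *
        ∑ j, ‖u j‖ ^ 2
      ≤ ∑ ν, ‖∑ j, u j * star (vandermonde N t j ν)‖ ^ 2 := by
  have hlog : 0 ≤ Real.log d := Real.log_nonneg (by exact_mod_cast hd)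
  have hN' : (0 : ℝ) < (N : ℝ) - 1 := by
    have : (1 : ℝ) < N := by exact_mod_cast hN
    linarith
  have hpi := Real.pi_pos
  have hconst := const_le_bumpInt_ratio hd
  have hfact := two_sqrt_two_mul_factorial_le hd
  set p := ⌈Real.log d⌉₊ + 1
  set Λ := 4 * Real.log d + 7
  set κ := √2 / (3 * Real.exp 1 ^ 2) * (1 / √(Real.log d + 1)) with hκ
  have hκ0 : 0 < κ := by positivity
  set a := Λ / (Real.pi * ((N : ℝ) - 1)) with ha_def
  have ha : 0 < a := by positivity
  have hI := bumpInt_pos p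
  have hI2 := bumpInt_pos (2 * p)
  set R := (Real.pi * ((N : ℝ) - 1)) ^ (2 * p) with hR
  have hR0 : 0 < R := by positivity
  set A := a * bumpInt (2 * p) with hA
  have hA0 : 0 < A := by positivity
  set K := a * bumpInt p with hK
  have hK0 : 0 < K := by positivity
  set T := ∑ ν, ‖∑ j, u j * star (vandermonde N t j ν)‖ ^ 2
  set U := ∑ j, ‖u j‖ ^ 2
  have hU : 0 ≤ U := by positivity
  have hmain : U * (R * A ^ d - d * ((2 * p).factorial * a⁻¹ ^ (2 * p) * K * A ^ (d - 1)))
      ≤ R * (K ^ 2) ^ d * T := le_sum_box ha ha' ht hN.le u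
  have hΛ : 0 < Λ := by positivity
  have hRa : R = Λ ^ (2 * p) * a⁻¹ ^ (2 * p) := by
    rw [hR, ← mul_pow, ha_def]
    congr 1
    field_simp
  -- The derivative terms take at most half of the main term; this is the source of the factor 1/√2
  -- in the theorem.
  have hB : d * ((2 * p).factorial * a⁻¹ ^ (2 * p) * K) ≤ R * A / 2 := by
    have h1 : K ≤ √2 * A := by
      have := mul_le_mul_of_nonneg_left (bumpInt_le_sqrt_two_mul p) ha.le
      rw [hK, hA]
      linarith
    calc d * ((2 * p).factorial * a⁻¹ ^ (2 * p) * K)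
        ≤ d * ((2 * p).factorial * a⁻¹ ^ (2 * p) * (√2 * A)) := by gcongr
      _ = (2 * √2 * d * (2 * p).factorial) * a⁻¹ ^ (2 * p) * A / 2 := by ring
      _ ≤ Λ ^ (2 * p) * a⁻¹ ^ (2 * p) * A / 2 := by gcongr
      _ = R * A / 2 := by rw [hRa]
  have hBd : d * ((2 * p).factorial * a⁻¹ ^ (2 * p) * K * A ^ (d - 1)) ≤ R * A ^ d / 2 := by
    have := mul_le_mul_of_nonneg_right hB (pow_nonneg hA0.le (d - 1))
    have h2 : A ^ d = A * A ^ (d - 1) := by rw [← pow_succ', Nat.sub_add_cancel hd]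
    rw [h2]
    linarith
  have hAT : A ^ d / 2 * U ≤ (K ^ 2) ^ d * T := by
    have h1 : R * (A ^ d / 2 * U) ≤ R * ((K ^ 2) ^ d * T) := by nlinarith
    exact le_of_mul_le_mul_left h1 hR0
  have hκK : κ * ((N : ℝ) - 1) * K ^ 2 ≤ A := by
    have h1 : κ * ((N : ℝ) - 1) * K ^ 2 = a * (κ * Λ / Real.pi * bumpInt p ^ 2) := by
      rw [hK, ha_def]
      field_simp
    rw [h1]
    exact mul_le_mul_of_nonneg_left hconst ha.le
  have hpow : (κ * ((N : ℝ) - 1)) ^ d * (K ^ 2) ^ d ≤ A ^ d := by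
    rw [← mul_pow]
    exact pow_le_pow_left₀ (by positivity) hκK d
  have hfin : (K ^ 2) ^ d * ((κ * ((N : ℝ) - 1)) ^ d / 2 * U) ≤ (K ^ 2) ^ d * T := by
    refine le_trans ?_ hAT
    have := mul_le_mul_of_nonneg_right hpow hU
    linarith
  exact le_of_mul_le_mul_left hfin (by positivity)

theorem norm_vandermonde_apply {d M N : ℕ} (t : Fin M → Fin d → UnitAddCircle) (j : Fin M)
    (ν : Fin d → Fin N) : ‖vandermonde N t j ν‖ = 1 := by
  rw [vandermonde, Matrix.of_apply, norm_prod]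
  refine Finset.prod_eq_one fun s _ => ?_
  rw [norm_pow, Circle.norm_coe, one_pow]

theorem const_le_one {x : ℝ} (hx : 0 ≤ x) : √2 / (3 * Real.exp 1 ^ 2) * (1 / √(x + 1)) ≤ 1 := by
  have h1 : √2 ≤ 2 := by
    rw [Real.sqrt_le_left (by norm_num)]
    norm_num
  have h2 : 1 ≤ Real.exp 1 ^ 2 := one_le_pow₀ (Real.one_le_exp (by norm_num))
  have h3 : 1 ≤ √(x + 1) := Real.one_le_sqrt.2 (by linarith)
  refine mul_le_one₀ ?_ (by positivity) ?_
  · rw [div_le_one (by positivity)]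
    linarith
  · rw [div_le_one (by positivity)]
    exact h3

end Main

end TorusVandermonde

theorem mainTheorem1 (d M N : ℕ) (hd : 1 ≤ d) (hM : 1 ≤ M) (hN : 1 ≤ N)
    (t : Fin M → Fin d → UnitAddCircle) (ht : Function.Injective t)
    (hsep : ENNReal.ofReal ((8 * Real.log (d : ℝ) + 14) / Real.pi) ≤
      TorusVandermonde.minSep t * ((N - 1 : ℕ) : ℝ≥0∞)) :
    1 / √2 * (√2 / (3 * Real.exp 1 ^ 2) * (1 / √(Real.log (d : ℝ) + 1))) ^ ((d : ℝ) / 2) *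
        ((N : ℝ) - 1) ^ ((d : ℝ) / 2) ≤
      TorusVandermonde.sigmaMin (TorusVandermonde.vandermonde N t) := by
  have hlog : 0 ≤ Real.log d := Real.log_nonneg (by exact_mod_cast hd)
  -- For N = 1 the right side of `hsep` is 0, even for infinite separation, while the left side is
  -- positive.
  have hN1 : 1 < N := by
    by_contra h
    obtain rfl : N = 1 := by omega
    have h1 : 0 < (8 * Real.log (d : ℝ) + 14) / Real.pi := by positivity
    simp only [Nat.sub_self, Nat.cast_zero, mul_zero, nonpos_iff_eq_zero,
      ENNReal.ofReal_eq_zero] at hsep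
    linarith
  have hcast : ((N - 1 : ℕ) : ℝ) = (N : ℝ) - 1 := by
    rw [Nat.cast_sub hN, Nat.cast_one]
  have hN' : (0 : ℝ) < (N : ℝ) - 1 := by
    have : (1 : ℝ) < N := by exact_mod_cast hN1
    linarith
  have : Nonempty (Fin M) := ⟨⟨0, hM⟩⟩
  refine TorusVandermonde.le_sigmaMin _ (by positivity) fun u => ?_
  rw [TorusVandermonde.sq_const_mul_rpow (by positivity) hN'.le]
  -- A single node imposes no bound on a, so it is treated directly: all entries have modulus 1 and
  -- the energy is N^d |u|².
  rcases hM.eq_or_lt with rfl | hM1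
  · simp only [Fin.sum_univ_one, Fin.isValue, norm_mul, norm_star,
      TorusVandermonde.norm_vandermonde_apply, mul_one, Finset.sum_const, Finset.card_univ,
      Fintype.card_pi, Fintype.card_fin, Finset.prod_const, nsmul_eq_mul, Nat.cast_pow]
    refine mul_le_mul_of_nonneg_right ?_ (by positivity)
    refine (half_le_self (by positivity)).trans (pow_le_pow_left₀ (by positivity) ?_ d)
    refine (mul_le_of_le_one_left hN'.le (TorusVandermonde.const_le_one hlog)).trans ?_
    linarith
  · have hdist : ∀ j k, j ≠ k →
        2 * ((4 * Real.log d + 7) / (Real.pi * ((N : ℝ) - 1))) ≤ dist (t j) (t k) := by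
      intro j k hjk
      have := TorusVandermonde.le_dist_of_le_minSep (by omega) ht hsep hjk
      rw [hcast] at this
      refine le_trans (le_of_eq ?_) this
      field_simp
      ring
    refine TorusVandermonde.half_pow_mul_sum_le hd hN1 ?_ hdist u
    -- Two nodes are at most 1/2 apart on the torus, so 2a ≤ 1/2 and the bump fits in one period.
    have h1 := hdist ⟨0, hM⟩ ⟨1, hM1⟩ (by simp)
    have h2 := TorusVandermonde.dist_torus_le_half (t ⟨0, hM⟩) (t ⟨1, hM1⟩)
    linarith
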